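/- Let $l\ge 4$ be even. Take a round disc in the plane and plumb $l$ Hopf bands $H_0,\dots,H_{l-1}$ to it, arranged clockwise around the disc so that exactly the core curves $c_i,c_{i+1}$ of cyclically consecutive bands intersect (once, inside the disc), alternately positive and negative ($H_i$ is positive for even $i$ and negative for odd $i$). The bands are plumbed one after the other, in the order of a word $w$ in the Dehn twists $T_{c_0},\dots,T_{c_{l-1}}$ containing every twist exactly once, each new band on top of the surface already built (so of two neighbouring bands the later one runs above the earlier one). The boundary of the resulting surface is an oriented link $L_w$; it is a fibred link realising the Penner mapping class given by $w$ on curves that intersect in the pattern of a cycle of length $l$. The flow difference of $w$ is the number of $i\in\mathbf{Z}/l$ such that $T_{c_i}$ occurs in $w$ before $T_{c_{i+1}}$, minus the number of $i\in\mathbf{Z}/l$ such that it occurs after $T_{c_{i+1}}$. The Alexander polynomial $\Delta_L\in\mathbf{Z}[\sqrt t^{\,\pm1}]$ of an oriented link $L$ is the isotopy invariant determined by the value $1$ on the unknot and the skein relation $\Delta_{L_+}=\Delta_{L_-}+\left(\sqrt t-\frac1{\sqrt t}\right)\Delta_{L_0}$. Let $d\ge 0$ be an integer. If $w$ and $w'$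 are two such words with flow differences $d$ and $d+2$ respectively, then, writing $\Delta_{d,l}=\Delta_{L_w}$ and $\Delta_{d+2,l}=\Delta_{L_{w'}}$, $$\Delta_{d,l}-\Delta_{d+2,l}=\left(\sqrt t-\frac1{\sqrt t}\right)\left(\sqrt t^{\,d+1}-\sqrt t^{\,-(d+1)}\right).$$ -/

import Mathlib

/-! Oriented link diagrams in the plane, in Morse position, their isotopy moves, the Alexander
polynomial given by the skein relation, and the links bounding cyclic plumbings of Hopf bands. -/

namespace HopfPlumbing

open LaurentPolynomial

/-- The elementary pieces of a diagram, read from bottom to top.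
`cup b` is a local minimum which creates two neighbouring strands; the left one points upwards
if `b = true` and downwards if `b = false`, the right one points the other way.
`cap` is a local maximum, joining two neighbouring strands.
`cross e` is a crossing of two neighbouring strands; for `e = true` the strand running from
bottom left to top right is the upper one, for `e = false` it is the lower one. -/
inductive Gen where
  | cup (b : Bool)
  | cap
  | cross (e : Bool)

/-- Number of strands that enter the piece from below. -/
def Gen.bot : Gen → ℕ
  | .cup _ => 0
  | .cap => 2
  | .cross _ => 2

/-- Number of strands that leave the piece at the top. -/
def Gen.top : Gen → ℕ
  | .cup _ => 2
  | .cap => 0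
  | .cross _ => 2

/-- A layer `(i, g)` of a diagram: the piece `g` with exactly `i` vertical strands on its left. -/
abbrev Layer := ℕ × Gen

/-- The directions of the strands above a layer, given the directions below it, listed from left
to right (`true` is upwards); `none` if the layer does not fit. -/
def step (st : List Bool) : Layer → Option (List Bool)
  | (i, .cup b) => if i ≤ st.length then some (st.take i ++ b :: (!b) :: st.drop i) else none
  | (i, .cap) =>
    match st.drop i with
    | a :: c :: v => if a = c then none else some (st.take i ++ v)
    | _ => none
  | (i, .cross _) =>
    match st.drop i with
    | a :: c :: v => some (st.take i ++ c :: a :: v)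
    | _ => none

/-- The directions of the strands after a stack of layers. -/
def run (st : List Bool) (D : List Layer) : Option (List Bool) := D.foldlM step st

/-- A stack of layers is an oriented link diagram if the layers fit together consistently with
the orientations, and no strand is left open at the bottom or at the top. -/
def IsLinkDiagram (D : List Layer) : Prop := run [] D = some []

/-- The local moves between Morse diagrams which generate isotopy of links:
exchange of distant pieces, straightening of a strand, the three Reidemeister moves, and the
passage of a strand over or under a local extremum. -/
inductive LocalMove : List Layer → List Layer → Prop
  | exchange (i k : ℕ) (g h : Gen) :
      LocalMove [(i, g), (i + g.top + k, h)] [(i + g.bot + k, h), (i, g)]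
  | straightenLeft (i : ℕ) (b : Bool) : LocalMove [(i + 1, .cup b), (i, .cap)] []
  | straightenRight (i : ℕ) (b : Bool) : LocalMove [(i, .cup b), (i + 1, .cap)] []
  | reidemeister1Cap (i : ℕ) (e : Bool) :
      LocalMove [(i, .cross e), (i, .cap)] [(i, .cap)]
  | reidemeister1Cup (i : ℕ) (b e : Bool) :
      LocalMove [(i, .cup b), (i, .cross e)] [(i, .cup (!b))]
  | reidemeister2 (i : ℕ) (e : Bool) : LocalMove [(i, .cross e), (i, .cross (!e))] []
  | reidemeister3 (i : ℕ) (e : Bool) :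
      LocalMove [(i, .cross e), (i + 1, .cross e), (i, .cross e)]
        [(i + 1, .cross e), (i, .cross e), (i + 1, .cross e)]
  | slideCap (i : ℕ) (e : Bool) :
      LocalMove [(i + 1, .cross e), (i, .cap)] [(i, .cross (!e)), (i + 1, .cap)]
  | slideCup (i : ℕ) (b e : Bool) :
      LocalMove [(i, .cup b), (i + 1, .cross e)] [(i + 1, .cup b), (i, .cross (!e))]

/-- Two link diagrams that differ by one local move. -/
inductive Move : List Layer → List Layer → Prop
  | mk (A B x y : List Layer) (h : LocalMove x y)
      (hx : IsLinkDiagram (A ++ x ++ B)) (hy : IsLinkDiagram (A ++ y ++ B)) :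
      Move (A ++ x ++ B) (A ++ y ++ B)

/-- Isotopy of oriented links, on the level of diagrams. -/
def Isotopic : List Layer → List Layer → Prop := Relation.EqvGen Move

/-- The orientation-preserving smoothing of a crossing of strands with directions `a` (lower left)
and `c` (lower right): two vertical strands if `a = c`, a maximum below a minimum otherwise. -/
def smoothing (i : ℕ) (a c : Bool) : List Layer :=
  if a = c then [] else [(i, .cap), (i, .cup c)]

/-- `SkeinTriple P N Z`: the link diagrams `P`, `N`, `Z` agree except at one crossing, which is
positive in `P`, negative in `N` and smoothed in `Z`. The crossing lies between strands that have
the directions `a` and `c` below it, so it is positive if and only if the strand running from bottom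
left to top right is the upper one and `a = c`, or it is the lower one and `a ≠ c`. -/
inductive SkeinTriple : List Layer → List Layer → List Layer → Prop
  | mk (A B : List Layer) (u v : List Bool) (a c : Bool)
      (hA : run [] A = some (u ++ a :: c :: v))
      (hD : IsLinkDiagram (A ++ [(u.length, .cross (a == c))] ++ B)) :
      SkeinTriple (A ++ [(u.length, .cross (a == c))] ++ B)
        (A ++ [(u.length, .cross (!(a == c)))] ++ B)
        (A ++ smoothing u.length a c ++ B)

/-- The diagram of the unknot without crossings. -/
def unknot : List Layer := [(0, .cup true), (0, .cap)]

/-- `SkeinValue D p`: the Laurent polynomial `p` in the variable `T 1 = √t` is obtained for the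
link diagram `D` recursively from isotopy invariance, the value `1` on the unknot and the skein
relation `Δ(L₊) = Δ(L₋) + (√t - 1/√t) Δ(L₀)`, any two terms of which determine the third. -/
inductive SkeinValue : List Layer → ℤ[T;T⁻¹] → Prop
  | unknot : SkeinValue unknot 1
  | isotopic {D D' : List Layer} {p : ℤ[T;T⁻¹]} (h : Isotopic D D') (hp : SkeinValue D p) :
      SkeinValue D' p
  | positive {P N Z : List Layer} {n z : ℤ[T;T⁻¹]} (h : SkeinTriple P N Z)
      (hn : SkeinValue N n) (hz : SkeinValue Z z) : SkeinValue P (n + (T 1 - T (-1)) * z)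
  | negative {P N Z : List Layer} {p z : ℤ[T;T⁻¹]} (h : SkeinTriple P N Z)
      (hp : SkeinValue P p) (hz : SkeinValue Z z) : SkeinValue N (p - (T 1 - T (-1)) * z)
  | smoothed {P N Z : List Layer} {p n z : ℤ[T;T⁻¹]} (h : SkeinTriple P N Z)
      (hp : SkeinValue P p) (hn : SkeinValue N n) (hz : p = n + (T 1 - T (-1)) * z) :
      SkeinValue Z z

/-- `p` is the Alexander polynomial of the link with diagram `D`: the skein relation gives the
value `p` for `D`, and no other one. -/
def IsAlexanderPolynomial (D : List Layer) (p : ℤ[T;T⁻¹]) : Prop :=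
  ∀ x : ℤ[T;T⁻¹], SkeinValue D x ↔ x = p

/-! The curves `c_0, …, c_{l-1}` intersect in the pattern of a cycle, numbered clockwise. A product
of the Dehn twists in which every twist occurs exactly once is recorded by the permutation `w`
for which `w i` is the place of the twist along `c_i` in the product. -/

/-- The flow difference: the edge between `c_i` and the next curve `c_{i+1}` (indices modulo `l`)
is directed clockwise if the twist along `c_i` occurs before the twist along `c_{i+1}`, and
anticlockwise otherwise; count clockwise edges minus anticlockwise ones. -/
def flowDifference {l : ℕ} (w : Equiv.Perm (Fin l)) : ℤ :=
  ∑ i : Fin l, if w i < w (finRotate l i) then 1 else -1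

/-- A full twist in a band whose edges are the strands `0` and `1`, which have opposite
directions. Its two crossings are positive if `pos = true` (positive Hopf band) and negative
otherwise. -/
def fullTwist (pos : Bool) : List Layer := [(0, .cross (!pos)), (0, .cross (!pos))]

/-- The sector of the diagram in which a band ends and the next one begins. Below and above it, the
strands `0` and `1` are the outer and the inner edge of the only band present, and strand `2` is
the boundary of the disc, which lies on the right. Inside the sector, strand `2` leaves the
disc as the outer edge of the next band, whose inner edge is created by the cup. The old band
crosses the next band (four crossings) on its way to the disc: over it if `o = true`, under
it otherwise. There its outer edge becomes the boundary of the disc, and its inner edge turns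
back, along a short piece of the boundary of the disc, into the inner edge of the next band. -/
def bandCrossing (o : Bool) : List Layer :=
  [(3, .cup true), (1, .cross o), (0, .cross o), (2, .cross o), (1, .cross o),
    (3, .cap)]

/-- The boundary link of the surface obtained from a round disc by plumbing `l` Hopf bands
`H_0, …, H_{l-1}`, arranged clockwise around the disc such that exactly cyclically consecutive core
curves intersect (once, in the disc). `H_i` is positive for even `i` and negative for odd `i`. The
bands are plumbed on top of the surface in the order given by `w`, so of two neighbouring bands
the one plumbed later runs above the other. The first and the last three layers close up the
stack of sectors around the disc; the boundary of the disc is oriented anticlockwise. -/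
def plumbingLink {l : ℕ} (w : Equiv.Perm (Fin l)) : List Layer :=
  [(0, .cup false), (1, .cup true), (2, .cup false)] ++
    (List.finRange l).flatMap (fun i : Fin l =>
      fullTwist (decide (Even (i : ℕ))) ++ bandCrossing (decide (w (finRotate l i) < w i))) ++
    [(2, .cap), (1, .cap), (0, .cap)]

end HopfPlumbing

/-! The uniqueness of the skein value comes from a state sum of type `gl(1|1)`: a diagram is cut
open at its first minimum, its strands carry occupation numbers, and the sum of the weights of the
states is invariant under the local moves and satisfies the skein relation. Only for the moves at
the cut does this need more than a comparison of weights; there it follows from the odd symmetry of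
the model.

The existence comes from resolving the full twists of the bands one after the other. Up to isotopy,
a sector of the plumbing is a full twist followed by a half twist of three strands, whose direction
is the order of the two bands. Resolving a full twist leaves the untwisted band or the cut band, and
the half twists next to a cut can be undone whichever their directions are. So the Alexander
polynomial depends on the word only through the closure of the product of the half twists, that is,
through their signed number, which is minus the flow difference. -/

namespace HopfPlumbing

open LaurentPolynomial

/-! ### Directions of strands -/

theorem step_succ (a : Bool) (st : List Bool) (i : ℕ) (g : Gen) :
    step (a :: st) (i + 1, g) = (step st (i, g)).map (a :: ·) := by
  cases g with
  | cup b => by_cases h : i ≤ st.length <;> simp [step, h]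
  | cap =>
    simp only [step, List.drop_succ_cons, List.take_succ_cons]
    rcases st.drop i with _ | ⟨p, _ | ⟨q, v⟩⟩ <;> grind
  | cross e =>
    simp only [step, List.drop_succ_cons, List.take_succ_cons]
    rcases st.drop i with _ | ⟨p, _ | ⟨q, v⟩⟩ <;> rfl

theorem step_nil_succ (i : ℕ) (g : Gen) : step [] (i + 1, g) = none := by
  cases g <;> simp [step]

theorem run_cons (st : List Bool) (x : Layer) (D : List Layer) :
    run st (x :: D) = (step st x).bind (run · D) := rfl

@[simp] theorem run_nil (st : List Bool) : run st [] = some st := rfl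

theorem run_append (st : List Bool) (D E : List Layer) :
    run st (D ++ E) = (run st D).bind (run · E) :=
  List.foldlM_append

theorem run_cons_eq_some {st t : List Bool} {x : Layer} {D : List Layer} :
    run st (x :: D) = some t ↔ ∃ r, step st x = some r ∧ run r D = some t :=
  Option.bind_eq_some_iff

theorem run_append_eq_some {st t : List Bool} {D E : List Layer} :
    run st (D ++ E) = some t ↔ ∃ r, run st D = some r ∧ run r E = some t := by
  rw [run_append, Option.bind_eq_some_iff]

theorem run_context {st t st' t' : List Bool} {x A B : List Layer} (hA : run st' A = some st)
    (hx : run st x = some t) (hB : run t B = some t') : run st' (A ++ x ++ B) = some t' :=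
  run_append_eq_some.2 ⟨t, run_append_eq_some.2 ⟨st, hA, hx⟩, hB⟩

/-- The stack of layers `D` with `n` additional strands on the left. -/
def shift (n : ℕ) (D : List Layer) : List Layer := D.map (Prod.map (n + ·) id)

theorem shift_zero (D : List Layer) : shift 0 D = D := by
  have h (x : Layer) : Prod.map (0 + ·) id x = x := Prod.ext (Nat.zero_add x.1) rfl
  exact List.map_id'' h D

theorem shift_succ (n : ℕ) (D : List Layer) : shift (n + 1) D = shift 1 (shift n D) := by
  simp [shift, Function.comp_def, Prod.map, Nat.add_comm n 1, Nat.add_assoc]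

theorem shift_one_cons (x : Layer) (D : List Layer) :
    shift 1 (x :: D) = (x.1 + 1, x.2) :: shift 1 D := by
  simp [shift, Prod.map, Nat.add_comm]

theorem run_shift_one (a : Bool) (st : List Bool) (D : List Layer) :
    run (a :: st) (shift 1 D) = (run st D).map (a :: ·) := by
  induction D generalizing st with
  | nil => rfl
  | cons x D ih =>
    rw [shift_one_cons, run_cons, run_cons, step_succ]
    cases step st x with
    | none => rfl
    | some t => exact ih t

theorem run_shift (u st : List Bool) (D : List Layer) :
    run (u ++ st) (shift u.length D) = (run st D).map (u ++ ·) := by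
  induction u with
  | nil => simp [shift_zero]
  | cons a u ih =>
    rw [List.length_cons, shift_succ, List.cons_append, run_shift_one, ih, Option.map_map]
    rfl

theorem run_append_left {st t : List Bool} {D : List Layer} (u : List Bool)
    (h : run st D = some t) : run (u ++ st) (shift u.length D) = some (u ++ t) := by
  rw [run_shift, h, Option.map_some]

theorem step_append_right {st t : List Bool} {x : Layer} (r : List Bool)
    (h : step st x = some t) : step (st ++ r) x = some (t ++ r) := by
  obtain ⟨i, g⟩ := x
  induction i generalizing st t with
  | zero =>
    rcases g with b | _ | e
    · simp_all [step]
      grind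
    · rcases st with _ | ⟨a, _ | ⟨c, v⟩⟩ <;> simp_all [step]
    · rcases st with _ | ⟨a, _ | ⟨c, v⟩⟩ <;> simp_all [step]
      grind
  | succ i ih =>
    cases st with
    | nil => simp [step_nil_succ] at h
    | cons a st =>
      rw [step_succ] at h
      obtain ⟨u, hu, rfl⟩ := Option.map_eq_some_iff.1 h
      rw [List.cons_append, step_succ, ih hu]
      rfl

theorem run_append_right {st t : List Bool} {D : List Layer} (r : List Bool)
    (h : run st D = some t) : run (st ++ r) D = some (t ++ r) := by
  induction D generalizing st with
  | nil => simpa using h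
  | cons x D ih =>
    obtain ⟨u, hu, h⟩ := run_cons_eq_some.1 h
    exact run_cons_eq_some.2 ⟨u ++ r, step_append_right r hu, ih h⟩

theorem step_nil_eq_some {x : Layer} {t : List Bool} (h : step [] x = some t) :
    ∃ b, x = (0, .cup b) ∧ t = [b, !b] := by
  obtain ⟨i, _ | _ | _⟩ := x <;> simp_all [step]

theorem run_nil_cons {x : Layer} {D : List Layer} {t : List Bool}
    (h : run [] (x :: D) = some t) :
    ∃ b, x = (0, .cup b) ∧ run [b, !b] D = some t := by
  obtain ⟨u, hu, h⟩ := run_cons_eq_some.1 h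
  obtain ⟨b, rfl, rfl⟩ := step_nil_eq_some hu
  exact ⟨b, rfl, h⟩

/-! ### A state sum -/

/-- A strand of a state: its direction and its occupation number. -/
abbrev Strand := Bool × Bool

/-- The directions of the strands of a state. -/
abbrev dirs (L : List Strand) : List Bool := L.map Prod.fst

section StateModel

variable {R : Type*} [CommRing R] (s : Rˣ)

/-- The weight of a minimum whose left strand has the direction `b` and whose two strands have the
occupation number `x`. -/
def cupWeight : (b x : Bool) → R
  | true, _ => 1
  | false, false => s
  | false, true => -s

/-- The weight of a maximum joining two strands. -/
def capWeight : Strand → Strand → R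
  | (false, x), (true, y) => if x = y then 1 else 0
  | (true, false), (false, false) => ↑s⁻¹
  | (true, true), (false, true) => -↑s⁻¹
  | _, _ => 0

/-- The weight of a crossing of strands with directions `a`, `c` and occupation numbers `x`, `y`
below it, if each strand keeps its occupation number. -/
def keepWeight (e a c : Bool) : (x y : Bool) → R
  | false, false => if e = (a == c) then s else ↑s⁻¹
  | true, true => -(if e = (a == c) then ↑s⁻¹ else s)
  | _, _ => 1

/-- The weight of a crossing of strands with directions `a`, `c` and occupation numbers `x`, `y`
below it, if both occupation numbers change. -/
def changeWeight (e a c x y : Bool) : R :=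
  if (a == c) = (x != y) ∧ e = (a == x) then
    (if (if a = c then e else x) then s - ↑s⁻¹ else ↑s⁻¹ - s) else 0

/-- The value, at a state below it, of a piece of a diagram placed on the leftmost strands, as a
linear form in a function of the states above it. -/
noncomputable def Gen.act : Gen → List Strand → (List Strand → R) →ₗ[R] R
  | .cup b, L => ∑ x, cupWeight s b x • LinearMap.proj ((b, x) :: (!b, x) :: L)
  | .cap, p :: q :: L => capWeight s p q • LinearMap.proj L
  | .cross e, (a, x) :: (c, y) :: L =>
      keepWeight s e a c x y • LinearMap.proj ((c, y) :: (a, x) :: L) +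
        changeWeight s e a c x y • LinearMap.proj ((c, !y) :: (a, !x) :: L)
  | _, _ => 0

/-- The linear form `Gen.act` for a piece with `i` strands on its left. -/
noncomputable def actAt (g : Gen) : ℕ → List Strand → (List Strand → R) →ₗ[R] R
  | 0, L => g.act s L
  | _ + 1, [] => 0
  | i + 1, p :: L => actAt g i L ∘ₗ LinearMap.funLeft R R (p :: ·)

/-- The action of a stack of layers on functions of the states; the functions of the states at its
top are sent to functions of the states at its bottom. -/
noncomputable def act (D : List Layer) : Module.End R (List Strand → R) :=
  (D.map fun x => LinearMap.pi (actAt s x.2 x.1)).prod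

theorem act_nil (Φ : List Strand → R) (L : List Strand) : act s [] Φ L = Φ L := rfl

theorem act_cons (x : Layer) (D : List Layer) (Φ : List Strand → R) (L : List Strand) :
    act s (x :: D) Φ L = actAt s x.2 x.1 L (act s D Φ) := by
  simp only [act, List.map_cons, List.prod_cons, Module.End.mul_apply, LinearMap.pi_apply]

theorem act_append (D E : List Layer) (Φ : List Strand → R) :
    act s (D ++ E) Φ = act s D (act s E Φ) := by
  simp only [act, List.map_append, List.prod_append, Module.End.mul_apply]

theorem actAt_cup (b : Bool) (L : List Strand) (Φ : List Strand → R) :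
    actAt s (.cup b) 0 L Φ = cupWeight s b true * Φ ((b, true) :: (!b, true) :: L) +
      cupWeight s b false * Φ ((b, false) :: (!b, false) :: L) := by
  simp [actAt, Gen.act]

theorem actAt_cap (p q : Strand) (L : List Strand) (Φ : List Strand → R) :
    actAt s .cap 0 (p :: q :: L) Φ = capWeight s p q * Φ L := rfl

theorem actAt_cross (e a x c y : Bool) (L : List Strand) (Φ : List Strand → R) :
    actAt s (.cross e) 0 ((a, x) :: (c, y) :: L) Φ =
      keepWeight s e a c x y * Φ ((c, y) :: (a, x) :: L) +
        changeWeight s e a c x y * Φ ((c, !y) :: (a, !x) :: L) := rfl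

theorem actAt_succ_cons (g : Gen) (i : ℕ) (p : Strand) (L : List Strand) (Φ : List Strand → R) :
    actAt s g (i + 1) (p :: L) Φ = actAt s g i L fun M => Φ (p :: M) := rfl

theorem actAt_congr {g : Gen} {i : ℕ} {Φ Ψ : List Strand → R} {L : List Strand} {t : List Bool}
    (ht : step (dirs L) (i, g) = some t) (h : ∀ M, dirs M = t → Φ M = Ψ M) :
    actAt s g i L Φ = actAt s g i L Ψ := by
  induction i generalizing L t Φ Ψ with
  | zero =>
    rcases g with b | _ | e
    · simp_all [step, actAt_cup]
    · rcases L with _ | ⟨p, _ | ⟨q, L⟩⟩ <;> simp_all [step, actAt_cap]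
    · rcases L with _ | ⟨⟨a, x⟩, _ | ⟨⟨c, y⟩, L⟩⟩ <;> simp_all [step, actAt_cross]
  | succ i ih =>
    cases L with
    | nil => rfl
    | cons p L =>
      rw [dirs, List.map_cons, step_succ] at ht
      obtain ⟨t', ht', rfl⟩ := Option.map_eq_some_iff.1 ht
      exact ih ht' fun M hM => h _ (congrArg (p.1 :: ·) hM)

theorem act_congr {D : List Layer} {Φ Ψ : List Strand → R} {L : List Strand} {t : List Bool}
    (ht : run (dirs L) D = some t) (h : ∀ M, dirs M = t → Φ M = Ψ M) :
    act s D Φ L = act s D Ψ L := by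
  induction D generalizing L with
  | nil => exact h _ (Option.some.inj ht)
  | cons x D ih =>
    obtain ⟨t', ht', h'⟩ := run_cons_eq_some.1 ht
    rw [act_cons, act_cons]
    exact actAt_congr s ht' fun M hM => ih (hM ▸ h')

theorem act_shift_one (p : Strand) (Φ : List Strand → R) (L : List Strand) (D : List Layer) :
    act s (shift 1 D) Φ (p :: L) = act s D (fun M => Φ (p :: M)) L := by
  induction D generalizing L with
  | nil => rfl
  | cons x D ih =>
    rw [shift_one_cons, act_cons, act_cons, actAt_succ_cons]
    exact congrArg _ (funext ih)

/-- Two stacks of layers act in the same way on all states on which both can be placed. -/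
def ActEq (D E : List Layer) : Prop :=
  ∀ (Φ : List Strand → R) (L : List Strand) (t t' : List Bool),
    run (dirs L) D = some t → run (dirs L) E = some t' → act s D Φ L = act s E Φ L

variable {s}

theorem eq_nil_of_run_nil_shift_one {D : List Layer} {t : List Bool}
    (h : run [] (shift 1 D) = some t) : D = [] := by
  cases D with
  | nil => rfl
  | cons x D => simp [shift_one_cons, run_cons, step_nil_succ] at h

theorem ActEq.shift {D E : List Layer} (h : ActEq s D E) (i : ℕ) :
    ActEq s (shift i D) (shift i E) := by
  induction i with
  | zero => simpa only [shift_zero] using h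
  | succ i ih =>
    intro Φ L t t' ht ht'
    rw [shift_succ] at ht ht' ⊢
    rw [shift_succ i E]
    cases L with
    | nil => rw [eq_nil_of_run_nil_shift_one ht, eq_nil_of_run_nil_shift_one ht']
    | cons p L =>
      rw [dirs, List.map_cons, run_shift_one] at ht ht'
      obtain ⟨u, hu, -⟩ := Option.map_eq_some_iff.1 ht
      obtain ⟨u', hu', -⟩ := Option.map_eq_some_iff.1 ht'
      rw [act_shift_one, act_shift_one]
      exact ih _ L u u' hu hu'

theorem act_singleton (x : Layer) (Φ : List Strand → R) (L : List Strand) :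
    act s [x] Φ L = actAt s x.2 x.1 L Φ :=
  act_cons s x [] Φ L

theorem act_pair (x y : Layer) (Φ : List Strand → R) (L : List Strand) :
    act s [x, y] Φ L = actAt s x.2 x.1 L fun M => actAt s y.2 y.1 M Φ := by
  rw [act_cons, funext (act_singleton y Φ)]

theorem actEq_exchange (k : ℕ) (g h : Gen) :
    ActEq s [(0, g), (g.top + k, h)] [(g.bot + k, h), (0, g)] := by
  intro Φ L t t' _ _
  rw [act_pair, act_pair]
  rcases g with b | _ | e
  · simp only [Gen.top, Gen.bot, Nat.zero_add, Nat.add_comm 2 k, actAt_cup, actAt_succ_cons,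
      ← smul_eq_mul, ← map_smul, ← map_add]
    rfl
  · simp only [Gen.top, Gen.bot, Nat.zero_add, Nat.add_comm 2 k]
    rcases L with _ | ⟨p, _ | ⟨q, L⟩⟩
    · rfl
    · rfl
    · simp only [actAt_cap, actAt_succ_cons, ← smul_eq_mul, ← map_smul]
      rfl
  · simp only [Gen.top, Gen.bot, Nat.add_comm 2 k]
    rcases L with _ | ⟨⟨a, x⟩, _ | ⟨⟨c, y⟩, L⟩⟩
    · rfl
    · rfl
    · simp only [actAt_cross, actAt_succ_cons, ← smul_eq_mul, ← map_smul, ← map_add]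
      rfl

theorem actEq_straightenLeft (b : Bool) : ActEq s [(1, .cup b), (0, .cap)] [] := by
  rintro Φ (_ | ⟨⟨a, x⟩, L⟩) t t' h -
  · simp [run_cons, step] at h
  · obtain rfl : a = !b := by cases a <;> cases b <;> simp_all [run_cons, step]
    rw [act_pair, actAt_succ_cons, act_nil]
    cases b <;> cases x <;> simp [actAt_cup, actAt_cap, cupWeight, capWeight, ← mul_assoc]

theorem actEq_straightenRight (b : Bool) : ActEq s [(0, .cup b), (1, .cap)] [] := by
  rintro Φ (_ | ⟨⟨a, x⟩, L⟩) t t' h -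
  · simp [run_cons, step] at h
  · obtain rfl : a = b := by simp_all [run_cons, step]
    rw [act_pair, act_nil]
    cases a <;> cases x <;>
      simp [actAt_cup, actAt_cap, actAt_succ_cons, cupWeight, capWeight, ← mul_assoc]

theorem actEq_reidemeister1Cap (e : Bool) : ActEq s [(0, .cross e), (0, .cap)] [(0, .cap)] := by
  rintro Φ (_ | ⟨⟨a, x⟩, _ | ⟨⟨c, y⟩, L⟩⟩) t t' - h
  · simp [run_cons, step] at h
  · simp [run_cons, step] at h
  · obtain rfl : c = !a := by cases a <;> cases c <;> simp_all [run_cons, step]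
    have := s.mul_inv
    rw [act_pair, act_singleton]
    simp only [actAt_cross, actAt_cap]
    cases a <;> cases x <;> cases y <;> cases e <;>
      simp [keepWeight, changeWeight, capWeight] <;> grind

theorem actEq_reidemeister1Cup (b e : Bool) :
    ActEq s [(0, .cup b), (0, .cross e)] [(0, .cup (!b))] := by
  intro Φ L t t' _ _
  have := s.mul_inv
  rw [act_pair, act_singleton]
  simp only [actAt_cross, actAt_cup]
  cases b <;> cases e <;> simp [keepWeight, changeWeight, cupWeight] <;> grind

theorem actEq_reidemeister2 (e : Bool) : ActEq s [(0, .cross e), (0, .cross (!e))] [] := by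
  rintro Φ (_ | ⟨⟨a, x⟩, _ | ⟨⟨c, y⟩, L⟩⟩) t t' h -
  · simp [run_cons, step] at h
  · simp [run_cons, step] at h
  · have := s.mul_inv
    rw [act_pair, act_nil]
    simp only [actAt_cross]
    cases a <;> cases c <;> cases x <;> cases y <;> cases e <;>
      simp [keepWeight, changeWeight] <;> grind

theorem actEq_slideCap (e : Bool) :
    ActEq s [(1, .cross e), (0, .cap)] [(0, .cross (!e)), (1, .cap)] := by
  rintro Φ (_ | ⟨⟨a, x⟩, _ | ⟨⟨c, y⟩, _ | ⟨⟨d, z⟩, L⟩⟩⟩) t t' - h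
  · simp [run_cons, step] at h
  · simp [run_cons, step] at h
  · simp [run_cons, step] at h
  · obtain rfl : d = !a := by cases a <;> cases d <;> simp_all [run_cons, step]
    have := s.mul_inv
    rw [act_pair, act_pair]
    simp only [actAt_succ_cons, actAt_cross, actAt_cap]
    cases a <;> cases c <;> cases x <;> cases y <;> cases z <;> cases e <;>
      simp [keepWeight, changeWeight, capWeight] <;> grind

theorem actEq_slideCup (b e : Bool) :
    ActEq s [(0, .cup b), (1, .cross e)] [(1, .cup b), (0, .cross (!e))] := by
  rintro Φ (_ | ⟨⟨a, x⟩, L⟩) t t' h -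
  · simp [run_cons, step] at h
  · have := s.mul_inv
    rw [act_pair, act_pair]
    simp only [actAt_succ_cons, actAt_cross, actAt_cup]
    cases a <;> cases b <;> cases x <;> cases e <;>
      simp [keepWeight, changeWeight, cupWeight] <;> grind

set_option maxHeartbeats 1000000 in
-- The directions and occupation numbers of three strands and the type of crossing give 128 cases.
theorem actEq_reidemeister3 (e : Bool) :
    ActEq s [(0, .cross e), (1, .cross e), (0, .cross e)]
      [(1, .cross e), (0, .cross e), (1, .cross e)] := by
  rintro Φ (_ | ⟨⟨a, x⟩, _ | ⟨⟨c, y⟩, _ | ⟨⟨d, z⟩, L⟩⟩⟩) t t' h -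
  · simp [run_cons, step] at h
  · simp [run_cons, step] at h
  · simp [run_cons, step] at h
  · have := s.mul_inv
    simp only [act_cons, act_nil, actAt_succ_cons, actAt_cross]
    cases a <;> cases c <;> cases d <;> cases x <;> cases y <;> cases z <;> cases e <;>
      simp [keepWeight, changeWeight] <;> grind

theorem LocalMove.actEq {x y : List Layer} (h : LocalMove x y) : ActEq s x y := by
  cases h with
  | exchange i k g h =>
    rw [Nat.add_assoc, Nat.add_assoc]
    exact (actEq_exchange k g h).shift i
  | straightenLeft i b => exact (actEq_straightenLeft b).shift i
  | straightenRight i b => exact (actEq_straightenRight b).shift i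
  | reidemeister1Cap i e => exact (actEq_reidemeister1Cap e).shift i
  | reidemeister1Cup i b e => exact (actEq_reidemeister1Cup b e).shift i
  | reidemeister2 i e => exact (actEq_reidemeister2 e).shift i
  | reidemeister3 i e => exact (actEq_reidemeister3 e).shift i
  | slideCap i e => exact (actEq_slideCap e).shift i
  | slideCup i b e => exact (actEq_slideCup b e).shift i

variable (s)

/-- The grading factor of a strand. -/
def gradeWeight : Strand → R
  | (true, false) => ↑s⁻¹
  | (true, true) => -↑s⁻¹
  | (false, false) => s
  | (false, true) => -s

/-- The coefficients of the operators which raise (`α`) and lower (`β`) the charge of a strand. -/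
def flipWeight (α β : R) : Strand → R
  | (true, false) => α
  | (true, true) => β
  | (false, true) => s * α
  | (false, false) => -(s * β)

/-- The odd symmetry of the state model: a twisted derivation which changes the occupation number
of one strand, as a linear form for every state. -/
noncomputable def oddSymmetry (α β : R) : List Strand → (List Strand → R) →ₗ[R] R
  | [] => 0
  | p :: L => flipWeight s α β p • LinearMap.proj ((p.1, !p.2) :: L) +
      gradeWeight s p • oddSymmetry α β L ∘ₗ LinearMap.funLeft R R (p :: ·)

theorem oddSymmetry_cons (α β : R) (p : Strand) (L : List Strand) (Φ : List Strand → R) :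
    oddSymmetry s α β (p :: L) Φ = flipWeight s α β p * Φ ((p.1, !p.2) :: L) +
      gradeWeight s p * oddSymmetry s α β L fun M => Φ (p :: M) := rfl

theorem oddSymmetry_nil (α β : R) (Φ : List Strand → R) : oddSymmetry s α β [] Φ = 0 := rfl

theorem oddSymmetry_cup (α β : R) (Φ : List Strand → R) (b : Bool) (L : List Strand) :
    oddSymmetry s α β L (fun M => actAt s (.cup b) 0 M Φ) =
      actAt s (.cup b) 0 L fun M => oddSymmetry s α β M Φ := by
  have := s.mul_inv
  have hcup : (fun M => actAt s (.cup b) 0 M Φ) =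
      cupWeight s b true • (fun M => Φ ((b, true) :: (!b, true) :: M)) +
        cupWeight s b false • fun M => Φ ((b, false) :: (!b, false) :: M) :=
    funext fun M => actAt_cup s b M Φ
  rw [hcup, map_add, map_smul, map_smul, actAt_cup]
  simp only [oddSymmetry_cons, smul_eq_mul]
  cases b <;> simp [cupWeight, gradeWeight, flipWeight] <;> grind

theorem oddSymmetry_cap (α β : R) (Φ : List Strand → R) {p q : Strand} (h : q.1 = !p.1)
    (L : List Strand) :
    oddSymmetry s α β (p :: q :: L) (fun M => actAt s .cap 0 M Φ) =
      actAt s .cap 0 (p :: q :: L) fun M => oddSymmetry s α β M Φ := by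
  have := s.mul_inv
  obtain ⟨a, x⟩ := p
  obtain ⟨c, y⟩ := q
  obtain rfl : c = !a := h
  have hcap : (fun M => actAt s .cap 0 ((a, x) :: (!a, y) :: M) Φ) =
      capWeight s (a, x) (!a, y) • Φ := rfl
  rw [oddSymmetry_cons, oddSymmetry_cons, hcap, map_smul]
  simp only [actAt_cap, smul_eq_mul]
  cases a <;> cases x <;> cases y <;> simp [capWeight, gradeWeight, flipWeight] <;> grind

theorem oddSymmetry_cross (α β : R) (Φ : List Strand → R) (e : Bool) (p q : Strand)
    (L : List Strand) :
    oddSymmetry s α β (p :: q :: L) (fun M => actAt s (.cross e) 0 M Φ) =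
      actAt s (.cross e) 0 (p :: q :: L) fun M => oddSymmetry s α β M Φ := by
  have := s.mul_inv
  obtain ⟨a, x⟩ := p
  obtain ⟨c, y⟩ := q
  have hcross : (fun M => actAt s (.cross e) 0 ((a, x) :: (c, y) :: M) Φ) =
      keepWeight s e a c x y • (fun M => Φ ((c, y) :: (a, x) :: M)) +
        changeWeight s e a c x y • fun M => Φ ((c, !y) :: (a, !x) :: M) := rfl
  rw [oddSymmetry_cons, oddSymmetry_cons, hcross, map_add, map_smul, map_smul]
  simp only [oddSymmetry_cons, actAt_cross, smul_eq_mul]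
  clear hcross
  cases e <;> cases a <;> cases c <;> cases x <;> cases y <;>
    simp [keepWeight, changeWeight, gradeWeight, flipWeight] <;> grind

theorem oddSymmetry_actAt (α β : R) (Φ : List Strand → R) {g : Gen} {i : ℕ} {L : List Strand}
    {t : List Bool} (ht : step (dirs L) (i, g) = some t) :
    oddSymmetry s α β L (fun M => actAt s g i M Φ) =
      actAt s g i L fun M => oddSymmetry s α β M Φ := by
  induction i generalizing L t Φ with
  | zero =>
    rcases g with b | _ | e
    · exact oddSymmetry_cup s α β Φ b L
    · rcases L with _ | ⟨p, _ | ⟨q, L⟩⟩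
      · simp [step] at ht
      · simp [step] at ht
      · refine oddSymmetry_cap s α β Φ ?_ L
        grind [step]
    · rcases L with _ | ⟨p, _ | ⟨q, L⟩⟩
      · simp [step] at ht
      · simp [step] at ht
      · exact oddSymmetry_cross s α β Φ e p q L
  | succ i ih =>
    cases L with
    | nil => simp [step_nil_succ] at ht
    | cons p L =>
      rw [dirs, List.map_cons, step_succ] at ht
      obtain ⟨t', ht', -⟩ := Option.map_eq_some_iff.1 ht
      change _ = actAt s g i L (flipWeight s α β p • (fun M => Φ ((p.1, !p.2) :: M)) +
        gradeWeight s p • fun M => oddSymmetry s α β M fun N => Φ (p :: N))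
      rw [map_add, map_smul, map_smul, ← ih _ ht']
      rfl

/-- The value of a stack of layers on a state below it, no strand being left open at the top. -/
noncomputable def eval (D : List Layer) : List Strand → R :=
  act s D fun L => if L = [] then 1 else 0

theorem eval_cons (x : Layer) (D : List Layer) (L : List Strand) :
    eval s (x :: D) L = actAt s x.2 x.1 L (eval s D) :=
  act_cons s x D _ L

theorem oddSymmetry_eval (α β : R) {D : List Layer} {L : List Strand}
    (h : run (dirs L) D = some []) : oddSymmetry s α β L (eval s D) = 0 := by
  induction D generalizing L with
  | nil =>
    obtain rfl : L = [] := List.map_eq_nil_iff.1 (Option.some.inj h)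
    rfl
  | cons x D ih =>
    obtain ⟨t, ht, h'⟩ := run_cons_eq_some.1 h
    rw [funext (eval_cons s x D), oddSymmetry_actAt s α β _ ht, ← map_zero (actAt s x.2 x.1 L)]
    exact actAt_congr s ht fun M hM => ih (hM ▸ h')

theorem eval_congr {x y : List Layer} (h : ActEq s x y) {A B : List Layer} {L : List Strand}
    {t t' : List Bool} (hx : run (dirs L) (A ++ x ++ B) = some t)
    (hy : run (dirs L) (A ++ y ++ B) = some t') :
    eval s (A ++ x ++ B) L = eval s (A ++ y ++ B) L := by
  rw [List.append_assoc, run_append_eq_some] at hx hy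
  obtain ⟨u, hu, hx⟩ := hx
  obtain ⟨u', hu', hy⟩ := hy
  obtain rfl : u = u' := Option.some.inj (hu.symm.trans hu')
  obtain ⟨v, hv, -⟩ := run_append_eq_some.1 hx
  obtain ⟨v', hv', -⟩ := run_append_eq_some.1 hy
  simp only [eval, List.append_assoc, act_append]
  exact act_congr s hu fun M hM => h _ M v v' (hM ▸ hv) (hM ▸ hv')

/-- The normalising factor of a minimum at which a diagram is cut open. -/
def cutWeight : Bool → R
  | true => s
  | false => 1

/-- The state sum of a diagram which is cut open at its first minimum. -/
noncomputable def stateSum : List Layer → R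
  | (_, .cup b) :: D => cutWeight s b * eval s D [(b, false), (!b, false)]
  | _ => 0

theorem stateSum_cup (b : Bool) (D : List Layer) :
    stateSum s ((0, .cup b) :: D) = cutWeight s b * eval s D [(b, false), (!b, false)] := rfl

theorem stateSum_exchange (b b' : Bool) {D : List Layer} (h : run [b, !b, b', !b'] D = some []) :
    stateSum s ((0, .cup b) :: (2, .cup b') :: D) =
      stateSum s ((0, .cup b') :: (0, .cup b) :: D) := by
  have := s.mul_inv
  have symm (α β : R) (x y x' y' : Bool) :
      oddSymmetry s α β [(b, x), (!b, y), (b', x'), (!b', y')] (eval s D) = 0 :=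
    oddSymmetry_eval s α β h
  simp only [oddSymmetry_cons, oddSymmetry_nil] at symm
  simp only [stateSum_cup, eval_cons, actAt_succ_cons, actAt_cup]
  cases b <;> cases b'
  · have h₁ := symm 1 0 false false true false
    have h₂ := symm 0 1 false true false false
    simp only [Bool.not_true, Bool.not_false, flipWeight, gradeWeight, cutWeight, cupWeight]
      at h₁ h₂ ⊢
    grind only
  · have h₁ := symm 1 0 true false false false
    have h₂ := symm 0 1 false false true false
    simp only [Bool.not_true, Bool.not_false, flipWeight, gradeWeight, cutWeight, cupWeight]
      at h₁ h₂ ⊢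
    grind only
  · have h₁ := symm 1 0 false false true false
    have h₂ := symm 0 1 true false false false
    simp only [Bool.not_true, Bool.not_false, flipWeight, gradeWeight, cutWeight, cupWeight]
      at h₁ h₂ ⊢
    grind only
  · have h₁ := symm 1 0 false false false true
    have h₂ := symm 0 1 true false false false
    simp only [Bool.not_true, Bool.not_false, flipWeight, gradeWeight, cutWeight, cupWeight]
      at h₁ h₂ ⊢
    grind only

theorem stateSum_curl (b e : Bool) {D : List Layer} (h : run [!b, b] D = some []) :
    stateSum s ((0, .cup b) :: (0, .cross e) :: D) = stateSum s ((0, .cup (!b)) :: D) := by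
  have := s.mul_inv
  have symm : oddSymmetry s 1 0 [(!b, b), (b, !b)] (eval s D) = 0 := oddSymmetry_eval s 1 0 h
  simp only [oddSymmetry_cons, oddSymmetry_nil] at symm
  simp only [stateSum_cup, eval_cons, actAt_cross]
  cases b <;> cases e <;>
    simp [flipWeight, gradeWeight, cutWeight, keepWeight, changeWeight] at symm ⊢ <;> grind only

theorem stateSum_localMove_bottom {x y B : List Layer} (h : LocalMove x y)
    (hx : IsLinkDiagram (x ++ B)) (hy : IsLinkDiagram (y ++ B)) :
    stateSum s (x ++ B) = stateSum s (y ++ B) := by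
  cases h with
  | exchange i k g h =>
    obtain ⟨b, hg, hx⟩ := run_nil_cons hx
    obtain ⟨b', hh, -⟩ := run_nil_cons hy
    obtain ⟨rfl, rfl⟩ := Prod.mk.inj hg
    obtain ⟨hk, rfl⟩ := Prod.mk.inj hh
    obtain rfl : k = 0 := (Nat.add_eq_zero_iff.1 hk).2
    exact stateSum_exchange s b b' hx
  | reidemeister1Cup i b e =>
    obtain ⟨b', hg, hx⟩ := run_nil_cons hx
    obtain ⟨rfl, hb⟩ := Prod.mk.inj hg
    obtain rfl := Gen.cup.inj hb
    exact stateSum_curl s b e hx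
  | straightenRight i b =>
    obtain ⟨b', hg, hx⟩ := run_nil_cons hx
    obtain ⟨rfl, -⟩ := Prod.mk.inj hg
    simp [run_cons, step] at hx
  | slideCup i b e => obtain ⟨_, hg, -⟩ := run_nil_cons hy; simp at hg
  | straightenLeft | reidemeister1Cap | reidemeister2 | reidemeister3 | slideCap =>
    obtain ⟨_, hg, -⟩ := run_nil_cons hx
    simp at hg

theorem stateSum_move {D E : List Layer} (h : Move D E) : stateSum s D = stateSum s E := by
  obtain ⟨A, B, x, y, h, hx, hy⟩ := h
  cases A with
  | nil => exact stateSum_localMove_bottom s h hx hy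
  | cons a A =>
    obtain ⟨b, rfl, hA⟩ := run_nil_cons hx
    obtain ⟨b', hb, hA'⟩ := run_nil_cons hy
    obtain rfl := Gen.cup.inj (Prod.mk.inj hb).2
    exact congrArg (cutWeight s b * ·)
      (eval_congr s h.actEq (L := [(b, false), (!b, false)]) hA hA')

theorem stateSum_isotopic {D E : List Layer} (h : Isotopic D E) :
    stateSum s D = stateSum s E := by
  induction h with
  | rel _ _ h => exact stateSum_move s h
  | refl => rfl
  | symm _ _ _ ih => exact ih.symm
  | trans _ _ _ _ _ ih ih' => exact ih.trans ih'

theorem act_cross_skein (a x c y : Bool) (L : List Strand) (Φ : List Strand → R) :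
    act s [(0, .cross (a == c))] Φ ((a, x) :: (c, y) :: L) =
      act s [(0, .cross (!(a == c)))] Φ ((a, x) :: (c, y) :: L) +
        (s - ↑s⁻¹) * act s (smoothing 0 a c) Φ ((a, x) :: (c, y) :: L) := by
  have := s.mul_inv
  cases a <;> cases c <;> cases x <;> cases y <;>
    simp [smoothing, act_cons, act_nil, actAt_cross, actAt_cup, actAt_cap, keepWeight, changeWeight,
      cupWeight, capWeight] <;> grind only

theorem smoothing_succ (i : ℕ) (a c : Bool) :
    smoothing (i + 1) a c = shift 1 (smoothing i a c) := by
  cases a <;> cases c <;> simp [smoothing, shift, Prod.map, Nat.add_comm]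

theorem act_skein {u v : List Bool} {a c : Bool} {L : List Strand} (hL : dirs L = u ++ a :: c :: v)
    (Φ : List Strand → R) :
    act s [(u.length, .cross (a == c))] Φ L =
      act s [(u.length, .cross (!(a == c)))] Φ L +
        (s - ↑s⁻¹) * act s (smoothing u.length a c) Φ L := by
  induction u generalizing L Φ with
  | nil =>
    rcases L with _ | ⟨⟨a', x⟩, _ | ⟨⟨c', y⟩, L⟩⟩ <;> simp only [dirs, List.map_nil, List.map_cons,
      List.nil_append, List.cons.injEq, reduceCtorEq, and_false] at hL
    obtain ⟨rfl, rfl, -⟩ := hL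
    exact act_cross_skein s a' x c' y L Φ
  | cons b u ih =>
    cases L with
    | nil => simp at hL
    | cons p L =>
      have := ih (List.cons.inj hL).2 fun M => Φ (p :: M)
      rw [← act_shift_one, ← act_shift_one, ← act_shift_one, ← smoothing_succ, shift_one_cons,
        shift_one_cons] at this
      exact this

theorem eval_skein {A B : List Layer} {u v : List Bool} {a c : Bool} {L : List Strand}
    (hA : run (dirs L) A = some (u ++ a :: c :: v)) :
    eval s (A ++ [(u.length, .cross (a == c))] ++ B) L =
      eval s (A ++ [(u.length, .cross (!(a == c)))] ++ B) L +
        (s - ↑s⁻¹) * eval s (A ++ smoothing u.length a c ++ B) L := by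
  simp only [eval, List.append_assoc, act_append]
  rw [act_congr s hA fun M hM => act_skein s hM _]
  exact congrFun ((act s A).map_add _ ((s - ↑s⁻¹ : R) • act s (smoothing u.length a c) _)) L
    |>.trans (congrArg (_ + ·) (congrFun ((act s A).map_smul _ _) L))

theorem stateSum_skein {P N Z : List Layer} (h : SkeinTriple P N Z) :
    stateSum s P = stateSum s N + (s - ↑s⁻¹) * stateSum s Z := by
  obtain ⟨A, B, u, v, a, c, hA, -⟩ := h
  cases A with
  | nil => simp at hA
  | cons x A =>
    obtain ⟨b, rfl, hA'⟩ := run_nil_cons hA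
    simp only [List.cons_append, stateSum_cup]
    rw [eval_skein s (L := [(b, false), (!b, false)]) hA']
    ring

end StateModel

/-- The variable `√t` as a unit of the ring of Laurent polynomials. -/
noncomputable def sqrtT : (ℤ[T;T⁻¹])ˣ where
  val := T 1
  inv := T (-1)
  val_inv := (T_add 1 (-1)).symm
  inv_val := (T_add (-1) 1).symm

theorem T_one_sub_T_neg_one_ne_zero : (T 1 - T (-1) : ℤ[T;T⁻¹]) ≠ 0 := by
  intro h
  have hdeg := congrArg degree (sub_eq_zero.1 h)
  rw [degree_T, degree_T] at hdeg
  exact absurd hdeg (by decide)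

theorem SkeinValue.eq_stateSum {D : List Layer} {p : ℤ[T;T⁻¹]} (h : SkeinValue D p) :
    p = stateSum sqrtT D := by
  have skein {P N Z : List Layer} (h : SkeinTriple P N Z) :
      stateSum sqrtT P = stateSum sqrtT N + (T 1 - T (-1)) * stateSum sqrtT Z :=
    stateSum_skein sqrtT h
  induction h with
  | unknot =>
    rw [HopfPlumbing.unknot, stateSum_cup, eval_cons, actAt_cap]
    simp [eval, act_nil, capWeight, cutWeight]
  | isotopic h _ ih => rw [ih, stateSum_isotopic _ h]
  | positive h _ _ ih ih' => rw [ih, ih', skein h]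
  | negative h _ _ ih ih' => rw [ih, ih', skein h, add_sub_cancel_right]
  | smoothed h _ _ hz ih ih' =>
    rw [ih, ih', skein h, add_right_inj] at hz
    exact (mul_left_cancel₀ T_one_sub_T_neg_one_ne_zero hz).symm

theorem SkeinValue.isAlexanderPolynomial {D : List Layer} {p : ℤ[T;T⁻¹]} (h : SkeinValue D p) :
    IsAlexanderPolynomial D p :=
  fun _ => ⟨fun hx => hx.eq_stateSum.trans h.eq_stateSum.symm, fun hx => hx ▸ h⟩

/-! ### Isotopy of tangles -/

theorem LocalMove.shift {x y : List Layer} (h : LocalMove x y) (n : ℕ) :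
    LocalMove (shift n x) (shift n y) := by
  cases h with
  | exchange i k g h =>
    simpa only [HopfPlumbing.shift, List.map_cons, List.map_nil, Prod.map, id_eq, Nat.add_assoc]
      using LocalMove.exchange (n + i) k g h
  | straightenLeft i b => exact .straightenLeft (n + i) b
  | straightenRight i b => exact .straightenRight (n + i) b
  | reidemeister1Cap i e => exact .reidemeister1Cap (n + i) e
  | reidemeister1Cup i b e => exact .reidemeister1Cup (n + i) b e
  | reidemeister2 i e => exact .reidemeister2 (n + i) e
  | reidemeister3 i e => exact .reidemeister3 (n + i) e
  | slideCap i e => exact .slideCap (n + i) e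
  | slideCup i b e => exact .slideCup (n + i) b e

theorem LocalMove.reidemeister2_not (i : ℕ) (e : Bool) :
    LocalMove [(i, .cross (!e)), (i, .cross e)] [] := by
  simpa using LocalMove.reidemeister2 i (!e)

theorem LocalMove.slideCup_not (i : ℕ) (b e : Bool) :
    LocalMove [(i, .cup b), (i + 1, .cross (!e))] [(i + 1, .cup b), (i, .cross e)] := by
  simpa using LocalMove.slideCup i b (!e)

theorem LocalMove.slideCap_not (i : ℕ) (e : Bool) :
    LocalMove [(i + 1, .cross (!e)), (i, .cap)] [(i, .cross e), (i + 1, .cap)] := by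
  simpa using LocalMove.slideCap i (!e)

/-- Two tangle diagrams with the directions `st` at the bottom and `t` at the top which differ by
one local move. -/
inductive TangleMove (st t : List Bool) : List Layer → List Layer → Prop
  | mk (A B x y : List Layer) (h : LocalMove x y)
      (hx : run st (A ++ x ++ B) = some t) (hy : run st (A ++ y ++ B) = some t) :
      TangleMove st t (A ++ x ++ B) (A ++ y ++ B)

/-- Isotopy of tangle diagrams with the directions `st` at the bottom and `t` at the top. -/
def TangleIsotopic (st t : List Bool) : List Layer → List Layer → Prop :=
  Relation.EqvGen (TangleMove st t)

namespace TangleIsotopic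

variable {st t st' t' : List Bool} {x y z A B : List Layer}

theorem refl (x : List Layer) : TangleIsotopic st t x x := Relation.EqvGen.refl x

theorem symm (h : TangleIsotopic st t x y) : TangleIsotopic st t y x := Relation.EqvGen.symm _ _ h

theorem trans (h : TangleIsotopic st t x y) (h' : TangleIsotopic st t y z) :
    TangleIsotopic st t x z := Relation.EqvGen.trans _ _ _ h h'

instance : Trans (TangleIsotopic st t) (TangleIsotopic st t) (TangleIsotopic st t) := ⟨trans⟩

theorem move (A B : List Layer) (h : LocalMove x y) (hx : run st (A ++ x ++ B) = some t)
    (hy : run st (A ++ y ++ B) = some t) : TangleIsotopic st t (A ++ x ++ B) (A ++ y ++ B) :=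
  .rel _ _ (.mk A B x y h hx hy)

theorem context (h : TangleIsotopic st t x y) (hA : run st' A = some st)
    (hB : run t B = some t') : TangleIsotopic st' t' (A ++ x ++ B) (A ++ y ++ B) := by
  induction h with
  | rel _ _ h =>
    obtain ⟨C, D, x, y, h, hx, hy⟩ := h
    have hx' := run_context hA hx hB
    have hy' := run_context hA hy hB
    simp only [← List.append_assoc] at hx' hy' ⊢
    rw [List.append_assoc _ D] at hx' hy' ⊢
    rw [List.append_assoc _ D]
    exact move (A ++ C) (D ++ B) h hx' hy'
  | refl => exact refl _
  | symm _ _ _ ih => exact ih.symm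
  | trans _ _ _ _ _ ih ih' => exact ih.trans ih'

theorem append_right (r : List Bool) (h : TangleIsotopic st t x y) :
    TangleIsotopic (st ++ r) (t ++ r) x y := by
  refine h.mono fun _ _ h => ?_
  obtain ⟨A, B, x, y, h, hx, hy⟩ := h
  exact .mk A B x y h (run_append_right r hx) (run_append_right r hy)

theorem append_left (u : List Bool) (h : TangleIsotopic st t x y) :
    TangleIsotopic (u ++ st) (u ++ t) (shift u.length x) (shift u.length y) := by
  induction h with
  | rel _ _ h =>
    obtain ⟨A, B, x, y, h, hx, hy⟩ := h
    have hx' := run_append_left u hx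
    have hy' := run_append_left u hy
    simp only [shift, List.map_append] at hx' hy' ⊢
    exact move _ _ (h.shift u.length) hx' hy'
  | refl => exact refl _
  | symm _ _ _ ih => exact ih.symm
  | trans _ _ _ _ _ ih ih' => exact ih.trans ih'

theorem isotopic (h : TangleIsotopic [] [] x y) : Isotopic x y := by
  refine h.mono fun _ _ h => ?_
  obtain ⟨A, B, x, y, h, hx, hy⟩ := h
  exact .mk A B x y h hx hy

theorem circle_not {i : ℕ} (hi : i ≤ st.length) (b : Bool) :
    TangleIsotopic st st [(i, .cup (!b)), (i, .cap)] [(i, .cup b), (i, .cap)] := by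
  have hcircle (b : Bool) : run st [(i, .cup b), (i, .cap)] = some st := by
    simp [run_cons, step, hi]
  have hcurl : run st [(i, .cup b), (i, .cross true), (i, .cap)] = some st := by
    simp [run_cons, step, hi]
  exact (move [] [(i, .cap)] (.reidemeister1Cup i b true) hcurl (hcircle _)).symm.trans
    (move [(i, .cup b)] [] (.reidemeister1Cap i true) hcurl (hcircle b))

theorem curl (u v : List Bool) (a e : Bool) :
    TangleIsotopic (u ++ a :: v) (u ++ a :: v)
      [(u.length + 1, .cup a), (u.length, .cross e), (u.length + 1, .cap)] [] := by
  have h : TangleIsotopic [a] [a] [(1, .cup a), (0, .cross e), (1, .cap)] [] := by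
    cases a <;> exact
      (move [] [(1, .cap)] (.slideCup_not 0 _ e) rfl rfl).symm.trans <|
      (move [(0, .cup _)] [] (.reidemeister1Cap 1 (!e)) rfl rfl).trans <|
      move [] [] (.straightenRight 0 _) rfl rfl
  have := (h.append_left u).append_right v
  rw [List.append_assoc, List.singleton_append] at this
  exact this

end TangleIsotopic

theorem SkeinValue.congr {st t r : List Bool} {x y A B : List Layer} {p : ℤ[T;T⁻¹]}
    (h : SkeinValue (A ++ y ++ B) p) (hxy : TangleIsotopic st t x y)
    (hA : run [] A = some (st ++ r)) (hB : run (t ++ r) B = some []) :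
    SkeinValue (A ++ x ++ B) p :=
  .isotopic ((hxy.symm.append_right r).context hA hB).isotopic h

/-- The coefficient in the skein relation of the smoothing of a crossing, which is positive if
`pos = true` and negative otherwise. -/
noncomputable def skeinFactor (pos : Bool) : ℤ[T;T⁻¹] :=
  if pos then T 1 - T (-1) else T (-1) - T 1

theorem skeinFactor_not (pos : Bool) : skeinFactor (!pos) = -skeinFactor pos := by
  cases pos <;> simp [skeinFactor]

section Skein

variable {A B : List Layer} {u v : List Bool} {a c : Bool} {p q : ℤ[T;T⁻¹]}

theorem SkeinTriple.of_run (hA : run [] A = some (u ++ a :: c :: v))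
    (hB : run (u ++ c :: a :: v) B = some []) :
    SkeinTriple (A ++ [(u.length, .cross (a == c))] ++ B)
      (A ++ [(u.length, .cross (!(a == c)))] ++ B) (A ++ smoothing u.length a c ++ B) :=
  have hcross : run (a :: c :: v) [(0, .cross (a == c))] = some (c :: a :: v) := rfl
  .mk A B u v a c hA (run_context hA (run_append_left u hcross) hB)

theorem SkeinValue.crossing (e : Bool) (hp : SkeinValue (A ++ [(u.length, .cross (!e))] ++ B) p)
    (hq : SkeinValue (A ++ smoothing u.length a c ++ B) q)
    (hA : run [] A = some (u ++ a :: c :: v)) (hB : run (u ++ c :: a :: v) B = some []) :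
    SkeinValue (A ++ [(u.length, .cross e)] ++ B) (p + skeinFactor (e == (a == c)) * q) := by
  have triple := SkeinTriple.of_run hA hB
  obtain rfl | rfl := Bool.eq_or_eq_not e (a == c)
  · simpa only [skeinFactor, BEq.rfl, if_true] using .positive triple hp hq
  · rw [Bool.not_not] at hp
    convert SkeinValue.negative triple hp hq using 1
    rw [Bool.not_beq_self, skeinFactor, if_neg Bool.false_ne_true]
    ring

theorem SkeinValue.fullTwist (pos : Bool) (hp : SkeinValue (A ++ B) p)
    (hq : SkeinValue (A ++ [(0, .cap), (0, .cup false)] ++ B) q)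
    (hA : run [] A = some (false :: true :: v)) (hB : run (false :: true :: v) B = some []) :
    SkeinValue (A ++ HopfPlumbing.fullTwist pos ++ B) (p + skeinFactor pos * q) := by
  have hcurl : TangleIsotopic [false, true] [false, true]
      [(0, .cap), (0, .cup true), (0, .cross (!pos))] [(0, .cap), (0, .cup false)] :=
    .move [(0, .cap)] [] (.reidemeister1Cup 0 true (!pos)) rfl rfl
  have huncrossed : SkeinValue (A ++ [(0, .cross pos), (0, .cross (!pos))] ++ B) p :=
    SkeinValue.congr (st := [false, true]) (t := [false, true]) (y := [])
      (by rwa [List.append_nil])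
      (.move [] [] (.reidemeister2 0 pos) rfl rfl) hA hB
  have hsmoothed : SkeinValue (A ++ [(0, .cap), (0, .cup true), (0, .cross (!pos))] ++ B) q :=
    hq.congr hcurl hA hB
  have := SkeinValue.crossing (A := A) (B := (0, .cross (!pos)) :: B) (u := []) (a := false)
    (c := true) (!pos) (p := p) (q := q) (by simpa using huncrossed)
    (by simpa [smoothing] using hsmoothed) hA hB
  simpa [HopfPlumbing.fullTwist] using this

/-- Inserting a curl of either sign next to a strand does not change the link, so its smoothing,
which splits off a circle, has the value `0`. -/
theorem SkeinValue.circle (b : Bool) (h : SkeinValue (A ++ B) p)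
    (hA : run [] A = some (u ++ a :: v)) (hB : run (u ++ a :: v) B = some []) :
    SkeinValue (A ++ [(u.length + 1, .cup b), (u.length + 1, .cap)] ++ B) 0 := by
  have hcurl (e : Bool) : SkeinValue (A ++ [(u.length + 1, .cup a), (u.length, .cross e),
      (u.length + 1, .cap)] ++ B) p :=
    SkeinValue.congr (r := []) (y := []) (by rwa [List.append_nil]) (.curl u v a e)
      (by rwa [List.append_nil]) (by rwa [List.append_nil])
  have hcup : run (u ++ a :: v) [(u.length + 1, .cup a)] = some (u ++ a :: a :: (!a) :: v) :=
    run_append_left u (D := [(1, .cup a)]) (by simp [run_cons, step])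
  have hcap : run (u ++ a :: a :: (!a) :: v) [(u.length + 1, .cap)] = some (u ++ a :: v) :=
    run_append_left u (D := [(1, .cap)]) (by simp [run_cons, step])
  have triple := SkeinTriple.of_run (run_append_eq_some.2 ⟨_, hA, hcup⟩)
    (run_append_eq_some.2 ⟨_, hcap, hB⟩)
  have hcircle : SkeinValue (A ++ [(u.length + 1, .cup a), (u.length + 1, .cap)] ++ B) 0 := by
    simpa [smoothing] using SkeinValue.smoothed (z := 0) triple (by simpa using hcurl true)
      (by simpa using hcurl false) (by rw [mul_zero, add_zero])
  obtain rfl | rfl := Bool.eq_or_eq_not b a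
  · exact hcircle
  · exact hcircle.congr (r := []) (.circle_not (st := u ++ a :: v) (by simp) a)
      (by rwa [List.append_nil]) (by rwa [List.append_nil])

end Skein

/-! ### Half twists of three strands -/

open TangleIsotopic

section ThreeStrands

/-- The half twist of three strands. -/
def halfTwist (o : Bool) : List Layer := [(1, .cross o), (0, .cross o), (1, .cross o)]

/-- A product of half twists of three strands. -/
def halfTwists (H : List Bool) : List Layer := H.flatMap halfTwist

/-- The tangles which, like each sector of a plumbing, begin and end with the two edges of a band
and the boundary of the disc. -/
def IsBandTangle (x : List Layer) : Prop := run [false, true, false] x = some [false, true, false]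

variable {x y : List Layer}

theorem IsBandTangle.append (hx : IsBandTangle x) (hy : IsBandTangle y) : IsBandTangle (x ++ y) :=
  run_append_eq_some.2 ⟨_, hx, hy⟩

theorem IsBandTangle.flatMap {ι : Type*} {f : ι → List Layer} (hf : ∀ i, IsBandTangle (f i))
    (L : List ι) : IsBandTangle (L.flatMap f) := by
  induction L with
  | nil => rfl
  | cons i L ih => exact (hf i).append ih

theorem isBandTangle_halfTwist (o : Bool) : IsBandTangle (halfTwist o) := rfl

theorem isBandTangle_halfTwists (H : List Bool) : IsBandTangle (halfTwists H) :=
  .flatMap isBandTangle_halfTwist H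

theorem bandCrossing_halfTwist (o : Bool) :
    TangleIsotopic [false, true, false] [false, true, false] (bandCrossing o) (halfTwist o) :=
  calc
    TangleIsotopic [false, true, false] [false, true, false] _
        [(1, .cross o), (3, .cup true), (0, .cross o), (2, .cross o), (1, .cross o), (3, .cap)] :=
      (move [] [(0, .cross o), (2, .cross o), (1, .cross o), (3, .cap)]
        (.exchange 1 0 (.cross o) (.cup true)) rfl rfl).symm
    TangleIsotopic [false, true, false] [false, true, false] _
        [(1, .cross o), (0, .cross o), (3, .cup true), (2, .cross o), (1, .cross o), (3, .cap)] :=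
      (move [(1, .cross o)] [(2, .cross o), (1, .cross o), (3, .cap)]
        (.exchange 0 1 (.cross o) (.cup true)) rfl rfl).symm
    TangleIsotopic [false, true, false] [false, true, false] _
        [(1, .cross o), (0, .cross o), (3, .cup true), (2, .cross o), (3, .cap), (1, .cross o)] :=
      move [(1, .cross o), (0, .cross o), (3, .cup true), (2, .cross o)] []
        (.exchange 1 0 (.cross o) .cap) rfl rfl
    TangleIsotopic [false, true, false] [false, true, false] _
        [(1, .cross o), (0, .cross o), (1, .cross o)] :=
      (curl [false, false] [] true o).context (A := [(1, .cross o), (0, .cross o)])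
        (B := [(1, .cross o)]) rfl rfl

theorem halfTwist_cancel (o : Bool) :
    TangleIsotopic [false, true, false] [false, true, false] (halfTwist (!o) ++ halfTwist o) [] :=
  (move [(1, .cross (!o)), (0, .cross (!o))] [(0, .cross o), (1, .cross o)]
    (.reidemeister2_not 1 o) rfl rfl).trans <|
  (move [(1, .cross (!o))] [(1, .cross o)] (.reidemeister2_not 0 o) rfl rfl).trans <|
  (move [] [] (.reidemeister2_not 1 o) rfl rfl)

/-- The minimum which is created at the place `0` (for `j = false`) or `1` (for `j = true`) next to
a strand pointing downwards. -/
def cupAt (j : Bool) : Layer := (j.toNat, .cup j)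

/-- The maximum at the place `0` (for `j = false`) or `1` (for `j = true`). -/
def capAt (j : Bool) : Layer := (j.toNat, .cap)

theorem cupAt_fullTwist (pos : Bool) : TangleIsotopic [false] [false, true, false]
    (cupAt false :: fullTwist pos) [cupAt false] :=
  (move [] [(0, .cross (!pos))] (.reidemeister1Cup 0 false (!pos)) rfl rfl).trans <|
  move [] [] (.reidemeister1Cup 0 true (!pos)) rfl rfl

theorem cupAt_two_crossings (o : Bool) : TangleIsotopic [false] [false, true, false]
    [(1, .cup false), (0, .cross o), (1, .cross o)] [cupAt false] :=
  (move [] [(1, .cross o)] (.slideCup_not 0 false o) rfl rfl).symm.trans <|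
  move [(0, .cup false)] [] (.reidemeister2_not 1 o) rfl rfl

theorem cupAt_halfTwist (j o : Bool) : TangleIsotopic [false] [false, true, false]
    (cupAt j :: halfTwist o) [cupAt (!j)] := by
  cases j
  · exact (move [] [(0, .cross o), (1, .cross o)] (.slideCup 0 false o) rfl rfl).trans <|
      (move [(1, .cup false)] [(1, .cross o)] (.reidemeister2_not 0 o) rfl rfl).trans <|
      move [] [] (.reidemeister1Cup 1 false o) rfl rfl
  · exact (move [] [(0, .cross o), (1, .cross o)] (.reidemeister1Cup 1 true o) rfl rfl).trans <|
      cupAt_two_crossings o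

theorem two_crossings_capAt (o : Bool) : TangleIsotopic [false, true, false] [false]
    [(1, .cross o), (0, .cross o), (1, .cap)] [capAt false] :=
  (move [(1, .cross o)] [] (.slideCap_not 0 o) rfl rfl).symm.trans <|
  move [] [(0, .cap)] (.reidemeister2 1 o) rfl rfl

theorem halfTwist_capAt (j o : Bool) : TangleIsotopic [false, true, false] [false]
    (halfTwist o ++ [capAt j]) [capAt (!j)] := by
  cases j
  · exact (move [(1, .cross o), (0, .cross o)] [] (.slideCap 0 o) rfl rfl).trans <|
      (move [(1, .cross o)] [(1, .cap)] (.reidemeister2 0 o) rfl rfl).trans <|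
      move [] [] (.reidemeister1Cap 1 o) rfl rfl
  · exact (move [(1, .cross o), (0, .cross o)] [] (.reidemeister1Cap 1 o) rfl rfl).trans <|
      two_crossings_capAt o

theorem halfTwists_capAt (H : List Bool) (j : Bool) :
    TangleIsotopic [false, true, false] [false] (halfTwists H ++ [capAt j])
      [capAt (not^[H.length] j)] := by
  induction H with
  | nil => exact refl _
  | cons o H ih =>
    rw [List.length_cons, Function.iterate_succ_apply']
    have := ih.context (A := halfTwist o) (B := []) (isBandTangle_halfTwist o) rfl
    simp only [List.append_nil, ← List.append_assoc] at this
    exact this.trans (halfTwist_capAt _ o)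

end ThreeStrands

section Closures

/-- The three minima which close up a band tangle from below. -/
def bottomCups : List Layer := [(0, .cup false), (1, .cup true), (2, .cup false)]

/-- The three maxima which close up a band tangle from above. -/
def topCaps : List Layer := [(2, .cap), (1, .cap), (0, .cap)]

/-- The link diagram obtained by closing up a band tangle on the right. -/
def bandClosure (x : List Layer) : List Layer := bottomCups ++ x ++ topCaps

/-- The closure of a band tangle below which the band has been cut: the tangle begins with the
minimum `cupAt j`, and the upper part of the cut closes up, below it, to the minimum `cupAt k`. -/
def cutClosure (k j : Bool) (x : List Layer) : List Layer :=
  [cupAt false, cupAt k] ++ [cupAt j] ++ (x ++ topCaps)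

variable {x y z : List Layer} {p q r₁ r₂ : ℤ[T;T⁻¹]}

theorem run_bottomCups (hx : IsBandTangle x) :
    run [] (bottomCups ++ x) = some [false, true, false, true, false, true] :=
  run_append_eq_some.2 ⟨_, rfl, run_append_right [true, false, true] hx⟩

theorem run_topCaps (hx : IsBandTangle x) :
    run [false, true, false, true, false, true] (x ++ topCaps) = some [] :=
  run_append_eq_some.2 ⟨_, run_append_right [true, false, true] hx, rfl⟩

theorem run_cupAt_topCaps (j : Bool) (hx : IsBandTangle x) :
    run [false, true, false, true] ([cupAt j] ++ (x ++ topCaps)) = some [] :=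
  run_append_eq_some.2 ⟨_, by cases j <;> rfl, run_topCaps hx⟩

theorem run_cutClosure (k : Bool) :
    run [] [cupAt false, cupAt k] = some [false, true, false, true] := by
  cases k <;> rfl

theorem SkeinValue.bandClosure_congr (h : SkeinValue (bandClosure (y ++ z)) p)
    (hxy : TangleIsotopic [false, true, false] [false, true, false] x y) (hz : IsBandTangle z) :
    SkeinValue (bandClosure (x ++ z)) p := by
  have hyz : SkeinValue (bottomCups ++ y ++ (z ++ topCaps)) p := by
    simpa only [bandClosure, List.append_assoc] using h
  simpa only [bandClosure, List.append_assoc] using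
    hyz.congr (r := [true, false, true]) hxy rfl (run_topCaps hz)

theorem SkeinValue.cutClosure_congr {k j j' : Bool} {c : List Layer}
    (h : SkeinValue (cutClosure k j' x) p)
    (hc : TangleIsotopic [false] [false, true, false] (cupAt j :: c) [cupAt j'])
    (hx : IsBandTangle x) : SkeinValue (cutClosure k j (c ++ x)) p := by
  have := SkeinValue.congr (r := [true, false, true]) h hc (run_cutClosure k) (run_topCaps hx)
  simpa only [cutClosure, List.append_assoc, List.cons_append, List.nil_append] using this

theorem SkeinValue.cutClosure_halfTwist {k j : Bool} (o : Bool)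
    (h : SkeinValue (cutClosure k (!j) x) p) (hx : IsBandTangle x) :
    SkeinValue (cutClosure k j (halfTwist o ++ x)) p :=
  h.cutClosure_congr (cupAt_halfTwist j o) hx

theorem SkeinValue.cutClosure_false_fullTwist {k : Bool} (pos : Bool)
    (h : SkeinValue (cutClosure k false x) p) (hx : IsBandTangle x) :
    SkeinValue (cutClosure k false (HopfPlumbing.fullTwist pos ++ x)) p :=
  h.cutClosure_congr (cupAt_fullTwist pos) hx

theorem SkeinValue.cutClosure_true_fullTwist {k : Bool} (pos : Bool)
    (hp : SkeinValue (cutClosure k true x) p) (hq : SkeinValue (cutClosure k false x) q)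
    (hx : IsBandTangle x) :
    SkeinValue (cutClosure k true (HopfPlumbing.fullTwist pos ++ x)) (p + skeinFactor pos * q) := by
  have hcut : SkeinValue (cutClosure k true ([(0, .cap), (0, .cup false)] ++ x)) q :=
    hq.cutClosure_congr (move [] [cupAt false] (.straightenLeft 0 true) rfl rfl) hx
  have := SkeinValue.fullTwist (A := [cupAt false, cupAt k, cupAt true]) (B := x ++ topCaps) pos hp
    hcut (by cases k <;> rfl) (run_topCaps hx)
  exact this

theorem bottomCups_capAt (k : Bool) : TangleIsotopic [] [false, true, false, true]
    (bottomCups ++ [capAt k]) [cupAt false, cupAt k] := by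
  cases k
  · exact (move [(0, .cup false), (1, .cup true)] []
      (.exchange 0 0 .cap (.cup false)) rfl rfl).symm.trans <|
      move [(0, .cup false)] [(0, .cup false)] (.straightenLeft 0 true) rfl rfl
  · exact move [(0, .cup false), (1, .cup true)] [] (.straightenLeft 1 false) rfl rfl

theorem SkeinValue.of_cutClosure {k j : Bool} (h : SkeinValue (cutClosure k j x) p)
    (hx : IsBandTangle x) :
    SkeinValue (bottomCups ++ [capAt k] ++ ([cupAt j] ++ (x ++ topCaps))) p :=
  SkeinValue.congr (A := []) (r := []) h (bottomCups_capAt k) rfl (run_cupAt_topCaps j hx)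

theorem SkeinValue.bandClosure_fullTwist (H : List Bool) (pos : Bool)
    (hp : SkeinValue (bandClosure (halfTwists H ++ x)) p)
    (hq : SkeinValue (cutClosure (not^[H.length] false) false x) q) (hx : IsBandTangle x) :
    SkeinValue (bandClosure (halfTwists H ++ (HopfPlumbing.fullTwist pos ++ x)))
      (p + skeinFactor pos * q) := by
  have hcut : SkeinValue
      (bottomCups ++ (halfTwists H ++ [capAt false]) ++ ([cupAt false] ++ (x ++ topCaps))) q :=
    (hq.of_cutClosure hx).congr (r := [true, false, true]) (halfTwists_capAt H false) rfl
      (run_cupAt_topCaps false hx)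
  have := SkeinValue.fullTwist (A := bottomCups ++ halfTwists H) (B := x ++ topCaps) pos
    (by simpa only [bandClosure, List.append_assoc] using hp)
    (by simpa only [capAt, cupAt, Bool.toNat_false, List.append_assoc, List.cons_append,
      List.nil_append] using hcut)
    (run_bottomCups (isBandTangle_halfTwists H)) (run_topCaps hx)
  simpa only [bandClosure, List.append_assoc] using this

theorem SkeinValue.bandClosure_halfTwist (o : Bool)
    (hp : SkeinValue (bandClosure (halfTwist (!o) ++ x)) p) (hq : SkeinValue (bandClosure x) q)
    (h₁ : SkeinValue (cutClosure true false x) r₁) (h₂ : SkeinValue (cutClosure false true x) r₂)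
    (hx : IsBandTangle x) :
    SkeinValue (bandClosure (halfTwist o ++ x)) (p + skeinFactor o * (q - r₁ - r₂)) := by
  have hB := run_topCaps hx
  have hA : run [] bottomCups = some ([false, true, false] ++ [true, false, true]) := rfl
  have smoothed₃ : SkeinValue (bottomCups ++ [(1, .cross (!o)), (0, .cross (!o)), (1, .cap)] ++
      ([cupAt true] ++ (x ++ topCaps))) r₂ :=
    (h₂.of_cutClosure hx).congr (two_crossings_capAt (!o)) hA (run_cupAt_topCaps true hx)
  have smoothed₂ : SkeinValue (bandClosure ([(1, .cross (!o)), (1, .cross o)] ++ x)) q :=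
    hq.bandClosure_congr (y := []) (move [] [] (.reidemeister2_not 1 o) rfl rfl) hx
  have smoothed₁ : SkeinValue (bottomCups ++ [capAt true] ++
      [(1, .cup false), (0, .cross o), (1, .cross o)] ++ (x ++ topCaps)) r₁ :=
    SkeinValue.congr (r := [true, false, true])
      (by simpa only [List.append_assoc] using h₁.of_cutClosure hx) (cupAt_two_crossings o) rfl hB
  have crossed₃ := SkeinValue.crossing (A := bottomCups ++ [(1, .cross (!o)), (0, .cross (!o))])
    (B := x ++ topCaps) (u := [false]) (v := [true, false, true]) (a := false) (c := true) o
    hp smoothed₃ rfl hB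
  have crossed₂ := SkeinValue.crossing (A := bottomCups ++ [(1, .cross (!o))])
    (B := [(1, .cross o)] ++ (x ++ topCaps)) (u := []) (v := [true, true, false, true])
    (a := false) (c := false) o crossed₃ smoothed₂ rfl (by exact hB)
  have crossed₁ := SkeinValue.crossing (A := bottomCups)
    (B := [(0, .cross o), (1, .cross o)] ++ (x ++ topCaps)) (u := [false])
    (v := [true, false, true]) (a := true) (c := false) o crossed₂ smoothed₁ rfl (by exact hB)
  have hvalue : p + skeinFactor o * (q - r₁ - r₂) = p + skeinFactor (o == false) * r₂ +
      skeinFactor (o == true) * q + skeinFactor (o == false) * r₁ := by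
    rw [beq_false, beq_true, skeinFactor_not]
    ring
  rw [hvalue]
  exact crossed₁

end Closures

theorem skeinValue_unknot_false : SkeinValue [(0, .cup false), (0, .cap)] 1 :=
  .isotopic (circle_not (st := []) le_rfl false).isotopic .unknot

theorem skeinValue_unlink_two :
    SkeinValue [(0, .cup false), (1, .cup true), (1, .cap), (0, .cap)] 0 :=
  .circle (A := [(0, .cup false)]) (B := [(0, .cap)]) (u := []) (v := [true]) (a := false) true
    skeinValue_unknot_false rfl rfl

theorem skeinValue_bandClosure_nil : SkeinValue (bandClosure []) 0 :=
  .circle (A := [(0, .cup false), (1, .cup true)]) (B := [(1, .cap), (0, .cap)]) (u := [false])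
    (v := [false, true]) (a := true) false skeinValue_unlink_two rfl rfl

theorem skeinValue_zigzag :
    SkeinValue [(0, .cup false), (0, .cup false), (1, .cap), (0, .cap)] 1 :=
  .isotopic (move [(0, .cup false)] [(0, .cap)] (.straightenRight 0 false) rfl rfl).symm.isotopic
    skeinValue_unknot_false

theorem skeinValue_two_circles :
    SkeinValue [(0, .cup false), (0, .cup false), (0, .cap), (0, .cap)] 0 :=
  .isotopic (TangleIsotopic.isotopic <|
    (move [(0, .cup false), (2, .cup false)] [] (.exchange 0 0 .cap .cap) rfl rfl).symm.trans <|
    move [] [(0, .cap), (0, .cap)] (.exchange 0 0 (.cup false) (.cup false)) rfl rfl) <|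
  .circle (A := [(0, .cup false)]) (B := [(0, .cap)]) (u := [false]) (v := []) (a := true) false
    skeinValue_unknot_false rfl rfl

theorem skeinValue_cutClosure_nil (k j : Bool) :
    SkeinValue (cutClosure k j []) (if k = j then 0 else 1) := by
  cases k <;> cases j
  · exact .isotopic (TangleIsotopic.isotopic <|
      (move [(0, .cup false), (0, .cup false)] [(1, .cap), (0, .cap)]
        (.exchange 0 0 (.cup false) .cap) rfl rfl).trans <|
      (move [(0, .cup false), (0, .cup false), (0, .cap)] [(0, .cap)]
        (.straightenRight 0 false) rfl rfl)).symm skeinValue_two_circles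
  · exact .isotopic (TangleIsotopic.isotopic <|
      (move [(0, .cup false), (0, .cup false)] [(1, .cap), (0, .cap)]
        (.straightenRight 1 true) rfl rfl)).symm skeinValue_zigzag
  · exact .isotopic (TangleIsotopic.isotopic <|
      (move [(0, .cup false), (1, .cup true)] [(1, .cap), (0, .cap)]
        (.exchange 0 0 (.cup false) .cap) rfl rfl).trans <|
      (move [(0, .cup false)] [(0, .cup false), (1, .cap), (0, .cap)]
        (.straightenLeft 0 true) rfl rfl)).symm skeinValue_zigzag
  · exact .isotopic (TangleIsotopic.isotopic <|
      (move [(0, .cup false), (1, .cup true)] [(1, .cap), (0, .cap)]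
        (.straightenRight 1 true) rfl rfl)).symm skeinValue_unlink_two

/-- The sign of a half twist. -/
def halfSign (o : Bool) : ℤ := if o then 1 else -1

theorem even_halfSign_add (o : Bool) (n : ℤ) : Even (halfSign o + n) ↔ ¬ Even n := by
  cases o <;> simp [halfSign, Int.even_add]

theorem skeinValue_cutClosure_halfTwists (H : List Bool) (k j : Bool) :
    SkeinValue (cutClosure k j (halfTwists H))
      (if k = j ↔ Even (H.map halfSign).sum then 0 else 1) := by
  induction H generalizing j with
  | nil => simpa [halfTwists] using skeinValue_cutClosure_nil k j
  | cons o H ih =>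
    have hparity : (k = j ↔ Even ((o :: H).map halfSign).sum) ↔
        (k = !j ↔ Even (H.map halfSign).sum) := by
      rw [List.map_cons, List.sum_cons, even_halfSign_add]
      cases k <;> cases j <;> simp
    rw [if_congr hparity rfl rfl]
    exact (ih (!j)).cutClosure_halfTwist o (isBandTangle_halfTwists H)

theorem skeinValue_hopf (o : Bool) :
    SkeinValue [(0, .cup false), (1, .cup true), (0, .cross o), (0, .cross o), (1, .cap), (0, .cap)]
      (skeinFactor (!o)) := by
  have huncrossed : SkeinValue [(0, .cup false), (1, .cup true), (0, .cross (!o)), (0, .cross o),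
      (1, .cap), (0, .cap)] 0 :=
    .isotopic (move [(0, .cup false), (1, .cup true)] [(1, .cap), (0, .cap)]
      (.reidemeister2_not 0 o) rfl rfl).symm.isotopic skeinValue_unlink_two
  have hsmoothed : SkeinValue [(0, .cup false), (1, .cup true), (0, .cap), (0, .cup true),
      (0, .cross o), (1, .cap), (0, .cap)] 1 :=
    .isotopic (TangleIsotopic.isotopic <|
      (move [(0, .cup false)] [(0, .cup true), (0, .cross o), (1, .cap), (0, .cap)]
        (.straightenLeft 0 true) rfl rfl).trans <|
      (move [(0, .cup false)] [(1, .cap), (0, .cap)] (.reidemeister1Cup 0 true o) rfl rfl)).symm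
      skeinValue_zigzag
  have := SkeinValue.crossing (A := [(0, .cup false), (1, .cup true)])
    (B := [(0, .cross o), (1, .cap), (0, .cap)]) (u := []) (v := [false, true]) (a := false)
    (c := true) o huncrossed hsmoothed rfl rfl
  rw [zero_add, mul_one] at this
  rw [← beq_false]
  exact this

theorem skeinValue_bandClosure_halfTwist (o : Bool) :
    SkeinValue (bandClosure (halfTwist o)) (skeinFactor (!o)) :=
  .isotopic (TangleIsotopic.isotopic <|
    (move bottomCups topCaps (.reidemeister3 0 o) rfl rfl).symm.trans <|
    (move [(0, .cup false), (1, .cup true)] ([(1, .cross o), (0, .cross o)] ++ topCaps)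
      (.exchange 0 0 (.cross o) (.cup false)) rfl rfl).symm.trans <|
    (move [(0, .cup false), (1, .cup true), (0, .cross o), (2, .cup false), (1, .cross o)]
      [(1, .cap), (0, .cap)] (.exchange 0 0 (.cross o) .cap) rfl rfl).trans <|
    (curl [true] [false, true] false o).context
      (A := [(0, .cup false), (1, .cup true), (0, .cross o)])
      (B := [(0, .cross o), (1, .cap), (0, .cap)]) rfl rfl).symm
    (skeinValue_hopf o)

/-- The Alexander polynomial of the closure of `n` half twists of three strands, whose orientations
alternate. -/
noncomputable def halfTwistValue (n : ℤ) : ℤ[T;T⁻¹] :=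
  if Even n then 2 - T n - T (-n) else T (-n) - T n

theorem halfTwistValue_add_two (o : Bool) (n : ℤ) :
    halfTwistValue (halfSign o + (halfSign o + n)) =
      halfTwistValue n + skeinFactor o * (halfTwistValue (halfSign o + n) -
        (if Even n then 0 else 1) - (if Even n then 0 else 1)) := by
  have hunit : (T 1 * T (-1) : ℤ[T;T⁻¹]) = 1 := by rw [← T_add, add_neg_cancel, T_zero]
  cases o <;> by_cases hn : Even n <;>
    simp only [halfTwistValue, even_halfSign_add, hn, if_true, if_false, not_true, not_false_iff,
      neg_add, T_add] <;>
    simp only [halfSign, skeinFactor, Bool.false_eq_true, if_true, if_false, neg_neg] <;>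
    grind only

theorem skeinValue_bandClosure_halfTwists :
    ∀ H : List Bool, SkeinValue (bandClosure (halfTwists H)) (halfTwistValue (H.map halfSign).sum)
  | [] => by
    have : halfTwistValue 0 = 0 := by simp [halfTwistValue]; norm_num
    exact this ▸ skeinValue_bandClosure_nil
  | [o] => by
    have : halfTwistValue (halfSign o) = skeinFactor (!o) := by
      cases o <;> simp [halfTwistValue, halfSign, skeinFactor]
    rw [List.map_singleton, List.sum_singleton, this]
    exact skeinValue_bandClosure_halfTwist o
  | o' :: o :: H => by
    have hcancel : SkeinValue (bandClosure (halfTwist (!o) ++ halfTwists (o :: H)))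
        (halfTwistValue (H.map halfSign).sum) := by
      have := (skeinValue_bandClosure_halfTwists H).bandClosure_congr (y := [])
        (halfTwist_cancel o) (isBandTangle_halfTwists H)
      rwa [List.append_assoc] at this
    simp only [List.map_cons, List.sum_cons]
    obtain rfl | rfl := Bool.eq_or_eq_not o' o
    · rw [halfTwistValue_add_two]
      have hcut (k : Bool) := skeinValue_cutClosure_halfTwists (o' :: H) k (!k)
      exact hcancel.bandClosure_halfTwist o' (skeinValue_bandClosure_halfTwists (o' :: H))
        (by simpa [even_halfSign_add] using hcut true)
        (by simpa [even_halfSign_add] using hcut false) (isBandTangle_halfTwists _)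
    · have : halfSign (!o) + (halfSign o + (H.map halfSign).sum) = (H.map halfSign).sum := by
        cases o <;> simp [halfSign]
      rw [this]
      exact hcancel

/-! ### Cyclic plumbings -/

/-- A sequence of sectors of a cyclic plumbing, each given by the sign of its band and the direction
of its half twist. -/
def sectors (W : List (Bool × Bool)) : List Layer :=
  W.flatMap fun a => fullTwist a.1 ++ halfTwist a.2

theorem isBandTangle_sector (a : Bool × Bool) : IsBandTangle (fullTwist a.1 ++ halfTwist a.2) := rfl

theorem isBandTangle_sectors (W : List (Bool × Bool)) : IsBandTangle (sectors W) :=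
  .flatMap isBandTangle_sector W

/-- The Alexander polynomial of `cutClosure k j` of a sequence of sectors whose bands have the signs
in the list. -/
noncomputable def cutValue (k : Bool) : Bool → List Bool → ℤ[T;T⁻¹]
  | j, [] => if k = j then 0 else 1
  | false, _ :: S => cutValue k true S
  | true, pos :: S => cutValue k false S + skeinFactor pos * cutValue k true S

theorem skeinValue_cutClosure_sectors (k j : Bool) (W : List (Bool × Bool)) :
    SkeinValue (cutClosure k j (sectors W)) (cutValue k j (W.map Prod.fst)) := by
  induction W generalizing j with
  | nil => exact skeinValue_cutClosure_nil k j
  | cons a W ih =>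
    have hW := isBandTangle_sectors W
    have hhalf (j : Bool) := (ih (!j)).cutClosure_halfTwist (j := j) a.2 hW
    have hx := (isBandTangle_halfTwist a.2).append hW
    rw [sectors, List.flatMap_cons, List.append_assoc]
    cases j with
    | false => exact (hhalf false).cutClosure_false_fullTwist a.1 hx
    | true => exact (hhalf true).cutClosure_true_fullTwist a.1 (hhalf false) hx

/-- The contribution of the cut bands to the Alexander polynomial of the closure of a sequence of
sectors whose bands have the signs in the list; `k` is the parity of the number of half twists
below the sectors. -/
noncomputable def cutContribution : Bool → List Bool → ℤ[T;T⁻¹]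
  | _, [] => 0
  | k, pos :: S => cutContribution (!k) S + skeinFactor pos * cutValue k true S

theorem skeinValue_bandClosure_sectors (H : List Bool) (W : List (Bool × Bool)) :
    SkeinValue (bandClosure (halfTwists H ++ sectors W))
      (cutContribution (not^[H.length] false) (W.map Prod.fst) +
        halfTwistValue ((H ++ W.map Prod.snd).map halfSign).sum) := by
  induction W generalizing H with
  | nil => simpa [sectors, cutContribution] using skeinValue_bandClosure_halfTwists H
  | cons a W ih =>
    have hW := isBandTangle_sectors W
    have huncut := ih (H ++ [a.2])
    have hcut := (skeinValue_cutClosure_sectors (not^[H.length] false) true W).cutClosure_halfTwist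
      (j := false) a.2 hW
    rw [halfTwists, List.flatMap_append, List.flatMap_singleton, List.append_assoc,
      List.append_assoc] at huncut
    have := huncut.bandClosure_fullTwist H a.1 hcut ((isBandTangle_halfTwist a.2).append hW)
    rw [List.length_append, List.length_singleton, Function.iterate_succ_apply',
      add_right_comm] at this
    rw [sectors, List.flatMap_cons, List.append_assoc]
    exact this

section CyclicPlumbing

theorem TangleIsotopic.flatMap {ι : Type*} {f g : ι → List Layer}
    (h : ∀ i, TangleIsotopic [false, true, false] [false, true, false] (f i) (g i))
    (hf : ∀ i, IsBandTangle (f i)) (hg : ∀ i, IsBandTangle (g i)) (L : List ι) :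
    TangleIsotopic [false, true, false] [false, true, false] (L.flatMap f) (L.flatMap g) := by
  induction L with
  | nil => exact refl _
  | cons i L ih =>
    have htail := ih.context (A := f i) (B := []) (hf i) rfl
    have hhead := (h i).context (A := []) rfl (IsBandTangle.flatMap hg L)
    rw [List.append_nil, List.append_nil] at htail
    exact htail.trans hhead

variable {l : ℕ}

/-- The boundary link of a cyclic plumbing as in `plumbingLink`, but with arbitrary signs `ε` of the
Hopf bands. -/
def cyclicPlumbing (ε : Fin l → Bool) (w : Equiv.Perm (Fin l)) : List Layer :=
  bandClosure ((List.finRange l).flatMap fun i =>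
    fullTwist (ε i) ++ bandCrossing (decide (w (finRotate l i) < w i)))

/-- The sectors of a cyclic plumbing. -/
def plumbingSectors (ε : Fin l → Bool) (w : Equiv.Perm (Fin l)) : List (Bool × Bool) :=
  (List.finRange l).map fun i => (ε i, decide (w (finRotate l i) < w i))

theorem cyclicPlumbing_isotopic (ε : Fin l → Bool) (w : Equiv.Perm (Fin l)) :
    Isotopic (cyclicPlumbing ε w) (bandClosure (sectors (plumbingSectors ε w))) := by
  have h := TangleIsotopic.flatMap
    (f := fun i => fullTwist (ε i) ++ bandCrossing (decide (w (finRotate l i) < w i)))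
    (g := fun i => fullTwist (ε i) ++ halfTwist (decide (w (finRotate l i) < w i)))
    (fun i => by
      simpa only [List.append_nil] using (bandCrossing_halfTwist _).context
        (A := fullTwist (ε i)) (B := []) rfl rfl)
    (fun _ => rfl) (fun _ => rfl) (List.finRange l)
  rw [sectors, plumbingSectors, List.flatMap_map]
  exact ((h.append_right [true, false, true]).context rfl rfl).isotopic

theorem finRotate_ne_self (hl : l ≠ 1) (i : Fin l) : finRotate l i ≠ i := by
  obtain _ | _ | l := l
  · exact i.elim0
  · exact absurd rfl hl
  · rw [finRotate_apply]
    simp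

theorem sum_halfSign_plumbingSectors (hl : l ≠ 1) (ε : Fin l → Bool) (w : Equiv.Perm (Fin l)) :
    (((plumbingSectors ε w).map Prod.snd).map halfSign).sum = -flowDifference w := by
  rw [plumbingSectors, List.map_map, List.map_map, ← Fin.sum_univ_def, flowDifference,
    ← Finset.sum_neg_distrib]
  refine Finset.sum_congr rfl fun i _ => ?_
  have hne : w (finRotate l i) ≠ w i := w.injective.ne (finRotate_ne_self hl i)
  rcases hne.lt_or_gt with h | h
  · simp only [Function.comp_apply, halfSign, decide_eq_true h, if_neg h.not_gt, if_true, neg_neg]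
  · simp only [Function.comp_apply, halfSign, decide_eq_false h.not_gt, if_pos h,
      Bool.false_eq_true, if_false]

theorem even_flowDifference (w : Equiv.Perm (Fin l)) : Even (flowDifference w) ↔ Even l := by
  have h : Even (∑ i : Fin l, ((if w i < w (finRotate l i) then (1 : ℤ) else -1) + 1)) :=
    Finset.even_sum _ fun i _ => by split_ifs <;> decide
  rw [Finset.sum_add_distrib, Fin.sum_const, nsmul_one, Int.even_add] at h
  exact h.trans (Int.even_coe_nat l)

theorem exists_forall_halfTwistValue_neg_flowDifference (l : ℕ) :
    ∃ q : ℤ[T;T⁻¹], ∀ w : Equiv.Perm (Fin l), halfTwistValue (-flowDifference w) =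
      q - (-1) ^ l * T (flowDifference w) - T (-flowDifference w) := by
  by_cases hl : Even l
  · refine ⟨2, fun w => ?_⟩
    rw [halfTwistValue, if_pos ((even_flowDifference w).2 hl).neg, neg_neg, hl.neg_one_pow]
    ring
  · refine ⟨0, fun w => ?_⟩
    rw [halfTwistValue, if_neg (mt even_neg.1 (mt (even_flowDifference w).1 hl)), neg_neg,
      (Nat.not_even_iff_odd.1 hl).neg_one_pow]
    ring

end CyclicPlumbing

end HopfPlumbing

open HopfPlumbing LaurentPolynomial in
theorem proposition5p3_general {l : ℕ} (hl : l ≠ 1) (ε : Fin l → Bool) :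
    ∃ p : ℤ[T;T⁻¹], ∀ w : Equiv.Perm (Fin l), IsAlexanderPolynomial (cyclicPlumbing ε w)
      (p - (-1) ^ l * T (flowDifference w) - T (-flowDifference w)) := by
  obtain ⟨q, hq⟩ := exists_forall_halfTwistValue_neg_flowDifference l
  refine ⟨cutContribution false ((List.finRange l).map ε) + q, fun w => ?_⟩
  have hvalue := SkeinValue.isotopic (.symm _ _ (cyclicPlumbing_isotopic ε w))
    (skeinValue_bandClosure_sectors [] (plumbingSectors ε w))
  have hsigns : (plumbingSectors ε w).map Prod.fst = (List.finRange l).map ε := by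
    rw [plumbingSectors, List.map_map]
    rfl
  rw [List.nil_append, sum_halfSign_plumbingSectors hl, hq, hsigns, ← add_sub_assoc,
    ← add_sub_assoc] at hvalue
  exact hvalue.isAlexanderPolynomial

theorem proposition5p3 (l : ℕ) (hl : Even l) (d : ℕ) (w w' : Equiv.Perm (Fin l))
    (hw : HopfPlumbing.flowDifference w = (d : ℤ))
    (hw' : HopfPlumbing.flowDifference w' = (d : ℤ) + 2) :
    ∃ Δ Δ' : LaurentPolynomial ℤ,
      HopfPlumbing.IsAlexanderPolynomial (HopfPlumbing.plumbingLink w) Δ ∧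
      HopfPlumbing.IsAlexanderPolynomial (HopfPlumbing.plumbingLink w') Δ' ∧
      Δ - Δ' = (LaurentPolynomial.T 1 - LaurentPolynomial.T (-1)) *
        (LaurentPolynomial.T ((d : ℤ) + 1) - LaurentPolynomial.T (-((d : ℤ) + 1))) := by
  obtain ⟨p, hp⟩ := proposition5p3_general (l := l) (fun h => Nat.not_even_one (h ▸ hl))
    fun i => decide (Even (i : ℕ))
  refine ⟨_, _, hp w, hp w', ?_⟩
  simp only [hw, hw', hl.neg_one_pow, one_mul, mul_sub, sub_mul, ← LaurentPolynomial.T_add]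
  ring_nf
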